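/- Let $H_a\otimes H_b$ be a finite-dimensional bipartite quantum system, let $\Pi^1,\Pi^2$ be orthogonal projectors on $H_a$ with $\Pi^1+\Pi^2=\mathbb 1$, and let $x\in\mathbb R$. Put $\tau_1=\sqrt{\tfrac{1-\tanh x}{2}}$, $\tau_2=\sqrt{\tfrac{1+\tanh x}{2}}$, let $$\Omega_x=\tau_1\Pi^1+\tau_2\Pi^2,\qquad \Omega_{-x}=\tau_2\Pi^1+\tau_1\Pi^2$$ be the weak measurement operators of strength $x$, and let $\Omega(A)=\sum_{k=\pm x}(\Omega_k\otimes\mathbb 1)\,A\,(\Omega_k\otimes\mathbb 1)$. For a state (density operator) $\rho$ on $H_a\otimes H_b$ define the coherence of $\rho$ relative to the weak measurement by $$C_H(\rho|\Omega)=\big\|\sqrt\rho-\Omega(\sqrt\rho)\big\|^2,\qquad \|A\|=\sqrt{\operatorname{tr}(A^\dagger A)},$$ the affinity by $d(\rho|\Omega)=\operatorname{tr}\big(\sqrt\rho\,\Omega(\sqrt\rho)\big)$, and the Wigner–Yanase skew information of $\rho$ with respect to a Hermitian operator $K$ by $I(\rho,K)=-\tfrac12\operatorname{tr}\big([\sqrt\rho,K]^2\big)$.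 Then for every finite family of states $\rho_i$ on $H_a\otimes H_b$ and all $p_i\ge 0$ with $\sum_i p_i=1$: 1. $C_H\big(\sum_i p_i\rho_i\,\big|\,\Omega\big)\le\sum_i p_i\,C_H(\rho_i|\Omega)$; 2. $\sum_{k=\pm x}I\big(\sum_i p_i\rho_i,\Omega_k\otimes\mathbb 1\big)\le\sum_i p_i\sum_{k=\pm x}I(\rho_i,\Omega_k\otimes\mathbb 1)$; 3. $d\big(\sum_i p_i\rho_i\,\big|\,\Omega\big)\ge\sum_i p_i\,d(\rho_i|\Omega)$, that is, $1-d(\cdot|\Omega)$ is convex. -/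

import Mathlib

open scoped Kronecker MatrixOrder ComplexOrder

noncomputable section

/-- A quantum state (density matrix): positive semidefinite with unit trace. -/
def IsDensityMatrix {d : Type*} [Fintype d] (ρ : Matrix d d ℂ) : Prop :=
  ρ.PosSemidef ∧ ρ.trace = 1

/-- The Hilbert–Schmidt norm `√(tr (A† A))`; the trace is real and nonnegative. -/
def hsNorm {d : Type*} [Fintype d] (A : Matrix d d ℂ) : ℝ :=
  Real.sqrt (A.conjTranspose * A).trace.re

/-- The weak measurement operator `Ω_x = τ₁ Π¹ + τ₂ Π²` of strength `x`, where
`τ₁ = √((1 - tanh x) / 2)` and `τ₂ = √((1 + tanh x) / 2)`. -/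
def weakOp {m : Type*} (P Q : Matrix m m ℂ) (x : ℝ) : Matrix m m ℂ :=
  Real.sqrt ((1 - Real.tanh x) / 2) • P + Real.sqrt ((1 + Real.tanh x) / 2) • Q

/-- The second operator `Ω_{-x}` is `τ₂ Π¹ + τ₁ Π²`. -/
theorem weakOp_neg {m : Type*} (P Q : Matrix m m ℂ) (x : ℝ) :
    weakOp P Q (-x) =
      Real.sqrt ((1 + Real.tanh x) / 2) • P + Real.sqrt ((1 - Real.tanh x) / 2) • Q := by
  simp [weakOp, Real.tanh_neg, sub_eq_add_neg]

variable {m n : Type*} [Fintype m] [DecidableEq m] [Fintype n] [DecidableEq n]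

/-- The weak measurement of the first subsystem of a bipartite system,
`Ω(A) = ∑_{k = ± x} (Ω_k ⊗ 1) A (Ω_k ⊗ 1)`. -/
def weakMeas (P Q : Matrix m m ℂ) (x : ℝ) (A : Matrix (m × n) (m × n) ℂ) :
    Matrix (m × n) (m × n) ℂ :=
  (weakOp P Q x ⊗ₖ (1 : Matrix n n ℂ)) * A * (weakOp P Q x ⊗ₖ (1 : Matrix n n ℂ)) +
    (weakOp P Q (-x) ⊗ₖ (1 : Matrix n n ℂ)) * A * (weakOp P Q (-x) ⊗ₖ (1 : Matrix n n ℂ))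

/-- Coherence relative to the weak measurement, `C_H(ρ|Ω) = ‖√ρ - Ω(√ρ)‖²`. -/
def weakCoherence (P Q : Matrix m m ℂ) (x : ℝ) (ρ : Matrix (m × n) (m × n) ℂ) : ℝ :=
  hsNorm (CFC.sqrt ρ - weakMeas P Q x (CFC.sqrt ρ)) ^ 2

/-- The affinity `d(ρ|Ω) = tr (√ρ Ω(√ρ))`, which is real for states `ρ`. -/
def weakAffinity (P Q : Matrix m m ℂ) (x : ℝ) (ρ : Matrix (m × n) (m × n) ℂ) : ℝ :=
  (CFC.sqrt ρ * weakMeas P Q x (CFC.sqrt ρ)).trace.re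

/-- The Wigner–Yanase skew information `I(ρ, K) = -(1/2) tr ([√ρ, K]²)`, which is real for
positive semidefinite `ρ` and Hermitian `K`. -/
def skewInfo {d : Type*} [Fintype d] [DecidableEq d] (ρ K : Matrix d d ℂ) : ℝ :=
  -(1 / 2) * ((CFC.sqrt ρ * K - K * CFC.sqrt ρ) ^ 2).trace.re

/-- The total skew information of the weak measurement, `∑_{k = ± x} I(ρ, Ω_k ⊗ 1)`. -/
def weakSkewInfo (P Q : Matrix m m ℂ) (x : ℝ) (ρ : Matrix (m × n) (m × n) ℂ) : ℝ :=
  skewInfo ρ (weakOp P Q x ⊗ₖ (1 : Matrix n n ℂ)) +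
    skewInfo ρ (weakOp P Q (-x) ⊗ₖ (1 : Matrix n n ℂ))

end

/-!
All three inequalities come from the Wigner–Yanase–Lieb concavity of `ρ ↦ tr (√ρ K √ρ K)`.
For self-adjoint `Aᵢ`, `Bᵢ` with `∑ Aᵢ² ≤ T²` and `∑ Bᵢ² ≤ U²`, the operator Cauchy–Schwarz
inequality applied to `Aᵢ ⊗ 1` and `1 ⊗ Bᵢ`, together with the operator monotonicity of the square
root, gives `∑ Aᵢ ⊗ Bᵢ ≤ T ⊗ U`. Evaluating this at the vector of matrix entries of `K`, with
`Aᵢ` and `Bᵢ` the matrices `√pᵢ √ρᵢ` up to transposition, is the concavity of the trace functional.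
The affinity is a sum of two such functionals, the skew information is a linear functional of `ρ`
minus one of them, and the coherence is a constant multiple of the skew information with respect
to `Π¹ ⊗ 1`, because `A - Ω(A)` is a multiple of the off-diagonal part `Π¹ A Π² + Π² A Π¹`.
-/

lemma le_of_mul_self_le_mul_self {A : Type*} [NonUnitalCStarAlgebra A] [PartialOrder A]
    [StarOrderedRing A] {a b : A} (ha : IsSelfAdjoint a) (hb : 0 ≤ b) (h : a * a ≤ b * b) :
    a ≤ b := by
  have le_abs : a ≤ CFC.abs a := by
    rw [← sub_nonneg, CFC.abs_sub_self a]
    exact nsmul_nonneg (CFC.negPart_nonneg a) 2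
  calc a ≤ CFC.abs a := le_abs
    _ = CFC.sqrt (a * a) := by rw [CFC.abs, ha.star_eq]
    _ ≤ CFC.sqrt (b * b) := CFC.sqrt_le_sqrt _ _ h
    _ = b := CFC.sqrt_mul_self b

lemma star_mul_self_sum_star_mul_le {R ι : Type*} [Ring R] [PartialOrder R] [StarRing R]
    [StarOrderedRing R] {s : Finset ι} {c d : ι → R} (hc : ∑ i ∈ s, star (c i) * c i ≤ 1) :
    star (∑ i ∈ s, star (c i) * d i) * ∑ i ∈ s, star (c i) * d i ≤ ∑ i ∈ s, star (d i) * d i := by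
  set y := ∑ i ∈ s, star (c i) * d i with hy
  have star_y : star y = ∑ i ∈ s, star (d i) * c i := by simp [hy, star_sum]
  have residual_nonneg : 0 ≤ ∑ i ∈ s, star (d i - c i * y) * (d i - c i * y) :=
    Finset.sum_nonneg fun i _ => star_mul_self_nonneg _
  have residual_eq : ∑ i ∈ s, star (d i - c i * y) * (d i - c i * y) =
      ∑ i ∈ s, star (d i) * d i - star y * y -
        (star y * y - star y * (∑ i ∈ s, star (c i) * c i) * y) := by
    have cross : ∑ i ∈ s, star (d i) * (c i * y) = star y * y := by
      rw [star_y, Finset.sum_mul]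
      simp only [mul_assoc]
    have cross' : ∑ i ∈ s, star y * (star (c i) * d i) = star y * y := by
      rw [← Finset.mul_sum]
    simp only [star_sub, star_mul, mul_sub, sub_mul, Finset.sum_sub_distrib, Finset.mul_sum,
      Finset.sum_mul, mul_assoc, cross, cross']
  have contraction : star y * (∑ i ∈ s, star (c i) * c i) * y ≤ star y * y := by
    simpa using star_left_conjugate_le_conjugate hc y
  rw [residual_eq, sub_nonneg] at residual_nonneg
  exact sub_nonneg.1 ((sub_nonneg.2 contraction).trans residual_nonneg)

section

variable {A ι : Type*} [CStarAlgebra A] [PartialOrder A] [StarOrderedRing A]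
  {s : Finset ι} {a b : ι → A} {t u : A}

lemma sum_star_mul_le_mul_of_isStrictlyPositive (ht : IsStrictlyPositive t) (hu : 0 ≤ u)
    (hat : ∑ i ∈ s, star (a i) * a i ≤ t * t) (hbu : ∑ i ∈ s, star (b i) * b i ≤ u * u)
    (hab : IsSelfAdjoint (∑ i ∈ s, star (a i) * b i)) (htu : Commute t u) :
    ∑ i ∈ s, star (a i) * b i ≤ t * u := by
  obtain ⟨v, rfl⟩ := ht.isUnit
  obtain ⟨r, hr⟩ : ∃ r : A, r = ↑v⁻¹ := ⟨_, rfl⟩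
  have r_nonneg : 0 ≤ r := by simpa [hr] using ht.ringInverse.nonneg
  have r_star : star r = r := (IsSelfAdjoint.of_nonneg r_nonneg).star_eq
  have r_comm_u : Commute r u := hr ▸ htu.units_inv_left
  have conjugate_sum (c d : ι → A) : ∑ i ∈ s, star (c i * r) * (d i * r) =
      star r * (∑ i ∈ s, star (c i) * d i) * r := by
    simp only [star_mul, Finset.mul_sum, Finset.sum_mul, mul_assoc]
  have contraction : ∑ i ∈ s, star (a i * r) * (a i * r) ≤ 1 := calc
    _ = star r * (∑ i ∈ s, star (a i) * a i) * r := conjugate_sum a a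
    _ ≤ star r * (v * v) * r := star_left_conjugate_le_conjugate hat r
    _ = 1 := by rw [r_star, hr]; simp
  have conjugate_le : star r * (∑ i ∈ s, star (a i) * b i) * r ≤ r * u := by
    refine le_of_mul_self_le_mul_self (hab.conjugate' r) (r_comm_u.mul_nonneg r_nonneg hu) ?_
    calc star r * (∑ i ∈ s, star (a i) * b i) * r * (star r * (∑ i ∈ s, star (a i) * b i) * r)
        ≤ ∑ i ∈ s, star (b i * r) * (b i * r) := by
          simpa only [conjugate_sum, (hab.conjugate' r).star_eq] using
            star_mul_self_sum_star_mul_le (d := fun i => b i * r) contraction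
      _ = star r * (∑ i ∈ s, star (b i) * b i) * r := conjugate_sum b b
      _ ≤ star r * (u * u) * r := star_left_conjugate_le_conjugate hbu r
      _ = r * u * (r * u) := by rw [r_star, mul_assoc r u, mul_assoc r, mul_assoc u, r_comm_u.eq]
  calc ∑ i ∈ s, star (a i) * b i
      = star (v : A) * (star r * (∑ i ∈ s, star (a i) * b i) * r) * v := by
        rw [r_star, ht.isSelfAdjoint.star_eq, hr]; simp [mul_assoc]
    _ ≤ star (v : A) * (r * u) * v := star_left_conjugate_le_conjugate conjugate_le _
    _ = v * u := by rw [ht.isSelfAdjoint.star_eq, hr]; simp [htu.eq]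

lemma sum_star_mul_le_mul (ht : 0 ≤ t) (hu : 0 ≤ u)
    (hat : ∑ i ∈ s, star (a i) * a i ≤ t * t) (hbu : ∑ i ∈ s, star (b i) * b i ≤ u * u)
    (hab : IsSelfAdjoint (∑ i ∈ s, star (a i) * b i)) (htu : Commute t u) :
    ∑ i ∈ s, star (a i) * b i ≤ t * u := by
  have le_perturbed : ∀ ε : ℝ, 0 < ε → ∑ i ∈ s, star (a i) * b i ≤ (t + ε • 1) * u := fun ε hε => by
    have sq_le : t * t ≤ (t + ε • 1) * (t + ε • 1) := calc
      t * t ≤ t * t + ((2 * ε) • t + (ε * ε) • 1) :=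
        le_add_of_nonneg_right <| add_nonneg (smul_nonneg (by positivity) ht)
          (smul_nonneg (by positivity) zero_le_one)
      _ = (t + ε • 1) * (t + ε • 1) := by
        simp only [mul_add, add_mul, smul_mul_assoc, mul_smul_comm, mul_one, one_mul]
        module
    exact sum_star_mul_le_mul_of_isStrictlyPositive ((isStrictlyPositive_one.smul hε).nonneg_add ht)
      hu (hat.trans sq_le) hbu hab (htu.add_left ((Commute.one_left _).smul_left ε))
  have tendsto_perturbed :
      Filter.Tendsto (fun ε : ℝ => (t + ε • 1) * u) (nhdsWithin 0 (Set.Ioi 0)) (nhds (t * u)) := by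
    have : Continuous fun ε : ℝ => (t + ε • 1) * u := by fun_prop
    simpa using (this.tendsto 0).mono_left nhdsWithin_le_nhds
  exact ge_of_tendsto tendsto_perturbed (Filter.eventually_of_mem self_mem_nhdsWithin le_perturbed)

end

section

open Matrix

variable {m n ι : Type*}

lemma sum_kronecker {k l R : Type*} [NonUnitalNonAssocSemiring R] (s : Finset ι)
    (A : ι → Matrix k l R) (B : Matrix m n R) : (∑ i ∈ s, A i) ⊗ₖ B = ∑ i ∈ s, A i ⊗ₖ B := by
  ext ⟨_, _⟩ ⟨_, _⟩
  simp only [kronecker_apply, Matrix.sum_apply, Finset.sum_mul]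

lemma kronecker_sum {k l R : Type*} [NonUnitalNonAssocSemiring R] (s : Finset ι)
    (A : Matrix k l R) (B : ι → Matrix m n R) : A ⊗ₖ (∑ i ∈ s, B i) = ∑ i ∈ s, A ⊗ₖ B i := by
  ext ⟨_, _⟩ ⟨_, _⟩
  simp only [kronecker_apply, Matrix.sum_apply, Finset.mul_sum]

lemma isHermitian_kronecker {R : Type*} [CommMagma R] [StarMul R]
    {A : Matrix m m R} {B : Matrix n n R} (hA : A.IsHermitian) (hB : B.IsHermitian) :
    (A ⊗ₖ B).IsHermitian := by
  rw [IsHermitian, conjTranspose_kronecker, hA.eq, hB.eq]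

lemma kronecker_le_kronecker_left {𝕜 : Type*} [RCLike 𝕜] [Finite m] [Finite n] {A A' : Matrix m m 𝕜}
    {B : Matrix n n 𝕜} (hA : A ≤ A') (hB : B.PosSemidef) : A ⊗ₖ B ≤ A' ⊗ₖ B := by
  have : (A' - A) ⊗ₖ B = A' ⊗ₖ B - A ⊗ₖ B := map_sub ((kroneckerBilinear (R := 𝕜)).flip B) A' A
  exact Matrix.le_iff.2 (this ▸ (Matrix.le_iff.1 hA).kronecker hB)

lemma kronecker_le_kronecker_right {𝕜 : Type*} [RCLike 𝕜] [Finite m] [Finite n] {A : Matrix m m 𝕜}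
    {B B' : Matrix n n 𝕜} (hA : A.PosSemidef) (hB : B ≤ B') : A ⊗ₖ B ≤ A ⊗ₖ B' := by
  have : A ⊗ₖ (B' - B) = A ⊗ₖ B' - A ⊗ₖ B := map_sub (kroneckerBilinear (R := 𝕜) A) B' B
  exact Matrix.le_iff.2 (this ▸ hA.kronecker (Matrix.le_iff.1 hB))

variable [Fintype m] [Fintype n]

lemma sum_conjTranspose_mul_le_mul {s : Finset ι} {A B : ι → Matrix m m ℂ} {T U : Matrix m m ℂ}
    (hT : T.PosSemidef) (hU : U.PosSemidef)
    (hAT : ∑ i ∈ s, (A i)ᴴ * A i ≤ T * T) (hBU : ∑ i ∈ s, (B i)ᴴ * B i ≤ U * U)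
    (hAB : (∑ i ∈ s, (A i)ᴴ * B i).IsHermitian) (hTU : Commute T U) :
    ∑ i ∈ s, (A i)ᴴ * B i ≤ T * U := by
  classical
  open scoped Matrix.Norms.L2Operator in
  exact sum_star_mul_le_mul hT.nonneg hU.nonneg hAT hBU hAB hTU

lemma sum_kronecker_le_kronecker {s : Finset ι} {A : ι → Matrix m m ℂ} {B : ι → Matrix n n ℂ}
    {T : Matrix m m ℂ} {U : Matrix n n ℂ} (hT : T.PosSemidef) (hU : U.PosSemidef)
    (hAT : ∑ i ∈ s, (A i)ᴴ * A i ≤ T * T) (hBU : ∑ i ∈ s, (B i)ᴴ * B i ≤ U * U)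
    (hAB : (∑ i ∈ s, (A i)ᴴ ⊗ₖ B i).IsHermitian) :
    ∑ i ∈ s, (A i)ᴴ ⊗ₖ B i ≤ T ⊗ₖ U := by
  classical
  have left_sq_le := kronecker_le_kronecker_left hAT (.one (n := n))
  have right_sq_le := kronecker_le_kronecker_right (.one (n := m)) hBU
  have := sum_conjTranspose_mul_le_mul (s := s) (A := fun i => A i ⊗ₖ (1 : Matrix n n ℂ))
    (B := fun i => (1 : Matrix m m ℂ) ⊗ₖ B i) (hT.kronecker .one) (PosSemidef.one.kronecker hU)
  simp only [sum_kronecker, kronecker_sum, conjTranspose_kronecker, conjTranspose_one,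
    ← mul_kronecker_mul, mul_one, one_mul] at this left_sq_le right_sq_le
  exact this left_sq_le right_sq_le hAB (by simp [Commute, SemiconjBy, ← mul_kronecker_mul])

lemma star_vec_dotProduct_kronecker_mulVec_vec {R : Type*} [CommSemiring R] [StarRing R]
    (K : Matrix n m R) (A : Matrix m m R) (B : Matrix n n R) :
    star (vec K) ⬝ᵥ (Aᵀ ⊗ₖ B) *ᵥ vec K = (Kᴴ * B * K * A).trace := by
  simp only [kronecker_mulVec_vec, star_vec_dotProduct_vec, transpose_transpose, Matrix.mul_assoc]

lemma sum_trace_conjTranspose_mul_mul_mul_le {s : Finset ι} {A : ι → Matrix m m ℂ}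
    {B : ι → Matrix n n ℂ} {T : Matrix m m ℂ} {U : Matrix n n ℂ} (hT : T.PosSemidef)
    (hU : U.PosSemidef) (hA : ∀ i ∈ s, (A i).IsHermitian) (hB : ∀ i ∈ s, (B i).IsHermitian)
    (hAT : ∑ i ∈ s, A i * A i ≤ T * T) (hBU : ∑ i ∈ s, B i * B i ≤ U * U) (K : Matrix n m ℂ) :
    ∑ i ∈ s, (Kᴴ * B i * K * A i).trace ≤ (Kᴴ * U * K * T).trace := by
  have hA_transpose : ∀ i ∈ s, (A i)ᵀᴴ = (A i)ᵀ := fun i hi => (hA i hi).transpose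
  have left_sq_le : ∑ i ∈ s, (A i)ᵀᴴ * (A i)ᵀ ≤ Tᵀ * Tᵀ := calc
    _ = (∑ i ∈ s, A i * A i)ᵀ := by
      rw [transpose_sum]
      exact Finset.sum_congr rfl fun i hi => by rw [hA_transpose i hi, transpose_mul]
    _ ≤ (T * T)ᵀ := by
      simpa only [Matrix.le_iff, transpose_sub] using (Matrix.le_iff.1 hAT).transpose
    _ = Tᵀ * Tᵀ := transpose_mul T T
  have right_sq_le : ∑ i ∈ s, (B i)ᴴ * B i ≤ U * U := by
    rwa [Finset.sum_congr rfl fun i hi => congrArg (· * B i) (hB i hi).eq]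
  have kronecker_eq : ∑ i ∈ s, (A i)ᵀᴴ ⊗ₖ B i = ∑ i ∈ s, (A i)ᵀ ⊗ₖ B i :=
    Finset.sum_congr rfl fun i hi => by rw [hA_transpose i hi]
  have kronecker_le : ∑ i ∈ s, (A i)ᵀ ⊗ₖ B i ≤ Tᵀ ⊗ₖ U :=
    kronecker_eq ▸ sum_kronecker_le_kronecker hT.transpose hU left_sq_le right_sq_le
      (kronecker_eq ▸ isSelfAdjoint_sum s fun i hi =>
        isHermitian_kronecker (hA_transpose i hi) (hB i hi))
  have := (Matrix.le_iff.1 kronecker_le).dotProduct_mulVec_nonneg (vec K)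
  simpa only [sub_mulVec, sum_mulVec, dotProduct_sub, dotProduct_sum,
    star_vec_dotProduct_kronecker_mulVec_vec, sub_nonneg] using this

variable [DecidableEq m] [DecidableEq n] {s : Finset ι} {p : ι → ℝ} {ρ : ι → Matrix m m ℂ}

lemma isHermitian_sqrt (A : Matrix m m ℂ) : (CFC.sqrt A).IsHermitian :=
  (CFC.sqrt_nonneg A).posSemidef.isHermitian

lemma sum_sqrt_smul_sqrt_mul_self (hp : ∀ i ∈ s, 0 ≤ p i) (hρ : ∀ i ∈ s, (ρ i).PosSemidef) :
    ∑ i ∈ s, (√(p i) • CFC.sqrt (ρ i)) * (√(p i) • CFC.sqrt (ρ i)) =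
      CFC.sqrt (∑ i ∈ s, p i • ρ i) * CFC.sqrt (∑ i ∈ s, p i • ρ i) := by
  rw [CFC.sqrt_mul_sqrt_self _
    (Finset.sum_nonneg fun i hi => smul_nonneg (hp i hi) (hρ i hi).nonneg)]
  refine Finset.sum_congr rfl fun i hi => ?_
  rw [smul_mul_smul_comm, Real.mul_self_sqrt (hp i hi), CFC.sqrt_mul_sqrt_self _ (hρ i hi).nonneg]

lemma sum_smul_trace_sqrt_mul_sqrt_le {σ : ι → Matrix n n ℂ} (hp : ∀ i ∈ s, 0 ≤ p i)
    (hρ : ∀ i ∈ s, (ρ i).PosSemidef) (hσ : ∀ i ∈ s, (σ i).PosSemidef) (K : Matrix n m ℂ) :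
    ∑ i ∈ s, p i • (Kᴴ * CFC.sqrt (σ i) * K * CFC.sqrt (ρ i)).trace ≤
      (Kᴴ * CFC.sqrt (∑ i ∈ s, p i • σ i) * K * CFC.sqrt (∑ i ∈ s, p i • ρ i)).trace := calc
  _ = ∑ i ∈ s, (Kᴴ * (√(p i) • CFC.sqrt (σ i)) * K * (√(p i) • CFC.sqrt (ρ i))).trace :=
    Finset.sum_congr rfl fun i hi => by
      rw [Matrix.mul_smul, Matrix.mul_smul, Matrix.smul_mul, Matrix.smul_mul, smul_smul,
        Real.mul_self_sqrt (hp i hi), trace_smul]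
  _ ≤ _ := sum_trace_conjTranspose_mul_mul_mul_le (CFC.sqrt_nonneg _).posSemidef
    (CFC.sqrt_nonneg _).posSemidef
    (fun i _ => (isHermitian_sqrt (ρ i)).smul (.all _))
    (fun i _ => (isHermitian_sqrt (σ i)).smul (.all _))
    (sum_sqrt_smul_sqrt_mul_self hp hρ).le (sum_sqrt_smul_sqrt_mul_self hp hσ).le K

lemma sum_mul_re_trace_sqrt_mul_sqrt_mul_le {K : Matrix m m ℂ} (hK : K.IsHermitian)
    (hp : ∀ i ∈ s, 0 ≤ p i) (hρ : ∀ i ∈ s, (ρ i).PosSemidef) :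
    ∑ i ∈ s, p i * (CFC.sqrt (ρ i) * K * CFC.sqrt (ρ i) * K).trace.re ≤
      (CFC.sqrt (∑ i ∈ s, p i • ρ i) * K * CFC.sqrt (∑ i ∈ s, p i • ρ i) * K).trace.re := by
  have trace_eq (S : Matrix m m ℂ) : (S * K * S * K).trace = (Kᴴ * S * K * S).trace := by
    rw [hK.eq, trace_mul_comm]
    simp only [Matrix.mul_assoc]
  simpa only [trace_eq, Complex.re_sum, Complex.smul_re, smul_eq_mul] using
    (Complex.le_def.1 (sum_smul_trace_sqrt_mul_sqrt_le hp hρ hρ K)).1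

lemma skewInfo_eq_sub {A : Matrix m m ℂ} (hA : A.PosSemidef) (K : Matrix m m ℂ) :
    skewInfo A K = (A * (K * K)).trace.re - (CFC.sqrt A * K * CFC.sqrt A * K).trace.re := by
  obtain ⟨S, hS⟩ : ∃ S, S = CFC.sqrt A := ⟨_, rfl⟩
  have hSS : S * S = A := hS ▸ CFC.sqrt_mul_sqrt_self A hA.nonneg
  have commutator_sq : (S * K - K * S) ^ 2 =
      S * K * S * K - S * (K * K * S) - K * (S * S * K) + K * (S * K * S) := by noncomm_ring
  have outer : (S * (K * K * S)).trace = (A * (K * K)).trace := by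
    rw [trace_mul_comm, Matrix.mul_assoc, hSS, trace_mul_comm]
  have inner : (K * (S * S * K)).trace = (A * (K * K)).trace := by
    rw [trace_mul_comm, hSS, Matrix.mul_assoc]
  have alternating : (K * (S * K * S)).trace = (S * K * S * K).trace := trace_mul_comm _ _
  rw [skewInfo, ← hS, commutator_sq, trace_add, trace_sub, trace_sub, outer, inner, alternating]
  simp only [Complex.add_re, Complex.sub_re]
  ring

theorem skewInfo_sum_smul_le {K : Matrix m m ℂ} (hK : K.IsHermitian)
    (hp : ∀ i ∈ s, 0 ≤ p i) (hρ : ∀ i ∈ s, (ρ i).PosSemidef) :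
    skewInfo (∑ i ∈ s, p i • ρ i) K ≤ ∑ i ∈ s, p i * skewInfo (ρ i) K := calc
  _ = ∑ i ∈ s, p i * (ρ i * (K * K)).trace.re -
      (CFC.sqrt (∑ i ∈ s, p i • ρ i) * K * CFC.sqrt (∑ i ∈ s, p i • ρ i) * K).trace.re := by
    rw [skewInfo_eq_sub (posSemidef_sum s fun i hi => (hρ i hi).smul (hp i hi))]
    simp [Finset.sum_mul, trace_sum]
  _ ≤ ∑ i ∈ s, p i * (ρ i * (K * K)).trace.re -
      ∑ i ∈ s, p i * (CFC.sqrt (ρ i) * K * CFC.sqrt (ρ i) * K).trace.re :=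
    sub_le_sub_left (sum_mul_re_trace_sqrt_mul_sqrt_mul_le hK hp hρ) _
  _ = ∑ i ∈ s, p i * skewInfo (ρ i) K := by
    rw [← Finset.sum_sub_distrib]
    exact Finset.sum_congr rfl fun i hi => by rw [skewInfo_eq_sub (hρ i hi), mul_sub]

end

section

variable {R : Type*} [Ring R] {P Q : R}

lemma sub_add_mul_mul_eq_smul_offDiag {k : Type*} [CommRing k] [Algebra k R] (hPQ : P + Q = 1)
    {a b : k} (hab : a ^ 2 + b ^ 2 = 1) (A : R) :
    A - ((a • P + b • Q) * A * (a • P + b • Q) + (b • P + a • Q) * A * (b • P + a • Q)) =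
      (1 - 2 * (a * b)) • (P * A * Q + Q * A * P) := by
  have blocks : A = P * A * P + P * A * Q + Q * A * P + Q * A * Q := calc
    A = (P + Q) * A * (P + Q) := by rw [hPQ, one_mul, mul_one]
    _ = _ := by noncomm_ring
  have conjugates : (a • P + b • Q) * A * (a • P + b • Q) + (b • P + a • Q) * A * (b • P + a • Q) =
      (a ^ 2 + b ^ 2) • (P * A * P + Q * A * Q) + (2 * (a * b)) • (P * A * Q + Q * A * P) := by
    simp only [mul_add, add_mul, smul_mul_assoc, mul_smul_comm]
    module
  rw [conjugates, hab]
  nth_rw 1 [blocks]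
  module

lemma offDiag_sq_eq_neg_commutator_sq (hP : IsIdempotentElem P) (hPQ : P + Q = 1) (A : R) :
    (P * A * Q + Q * A * P) ^ 2 = -(A * P - P * A) ^ 2 := by
  obtain rfl : Q = 1 - P := eq_sub_of_add_eq' hPQ
  have upper_sq : P * A * (1 - P) * (P * A * (1 - P)) = 0 := calc
    _ = P * A * ((1 - P) * P) * A * (1 - P) := by simp only [mul_assoc]
    _ = 0 := by rw [hP.one_sub_mul_self, mul_zero, zero_mul, zero_mul]
  have lower_sq : (1 - P) * A * P * ((1 - P) * A * P) = 0 := calc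
    _ = (1 - P) * A * (P * (1 - P)) * A * P := by simp only [mul_assoc]
    _ = 0 := by rw [hP.mul_one_sub_self, mul_zero, zero_mul, zero_mul]
  have commutator_eq : A * P - P * A = (1 - P) * A * P - P * A * (1 - P) := by noncomm_ring
  rw [commutator_eq]
  generalize P * A * (1 - P) = X at *
  generalize (1 - P) * A * P = Y at *
  rw [sq, sq, add_mul, mul_add, mul_add, sub_mul, mul_sub, mul_sub, upper_sq, lower_sq]
  abel

end

section

open Matrix

lemma hsNorm_sq {d : Type*} [Fintype d] (A : Matrix d d ℂ) : hsNorm A ^ 2 = (Aᴴ * A).trace.re :=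
  Real.sq_sqrt (Complex.nonneg_iff.1 (posSemidef_conjTranspose_mul_self A).trace_nonneg).1

lemma isHermitian_weakOp {m : Type*} {P Q : Matrix m m ℂ} (hP : P.IsHermitian)
    (hQ : Q.IsHermitian) (x : ℝ) : (weakOp P Q x).IsHermitian :=
  (hP.smul (.all _)).add (hQ.smul (.all _))

variable {m n ι : Type*} [Fintype m] [DecidableEq m] [Fintype n] [DecidableEq n]
  {P Q : Matrix m m ℂ} {s : Finset ι} {p : ι → ℝ} {ρ : ι → Matrix (m × n) (m × n) ℂ}

lemma sub_weakMeas (hPQ : P + Q = 1) (x : ℝ) (A : Matrix (m × n) (m × n) ℂ) :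
    A - weakMeas P Q x A = (1 - 2 * (√((1 - Real.tanh x) / 2) * √((1 + Real.tanh x) / 2))) •
      ((P ⊗ₖ 1) * A * (Q ⊗ₖ 1) + (Q ⊗ₖ 1) * A * (P ⊗ₖ 1)) := by
  have hPQ_kronecker : P ⊗ₖ (1 : Matrix n n ℂ) + Q ⊗ₖ (1 : Matrix n n ℂ) = 1 := by
    rw [← add_kronecker, hPQ, one_kronecker_one]
  have sq_add_sq : √((1 - Real.tanh x) / 2) ^ 2 + √((1 + Real.tanh x) / 2) ^ 2 = 1 := by
    rw [Real.sq_sqrt (by linarith [Real.tanh_lt_one x]),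
      Real.sq_sqrt (by linarith [Real.neg_one_lt_tanh x])]
    ring
  rw [weakMeas, weakOp_neg, weakOp]
  simp only [add_kronecker, smul_kronecker]
  exact sub_add_mul_mul_eq_smul_offDiag hPQ_kronecker sq_add_sq A

theorem weakCoherence_eq_mul_skewInfo (hP : IsStarProjection P) (hPQ : P + Q = 1) (x : ℝ)
    (A : Matrix (m × n) (m × n) ℂ) :
    weakCoherence P Q x A =
      2 * (1 - 2 * (√((1 - Real.tanh x) / 2) * √((1 + Real.tanh x) / 2))) ^ 2 *
        skewInfo A (P ⊗ₖ (1 : Matrix n n ℂ)) := by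
  obtain rfl : Q = 1 - P := eq_sub_of_add_eq' hPQ
  have hP_kronecker : (P ⊗ₖ (1 : Matrix n n ℂ)).IsHermitian :=
    isHermitian_kronecker hP.isSelfAdjoint isHermitian_one
  have hQ_kronecker : ((1 - P) ⊗ₖ (1 : Matrix n n ℂ)).IsHermitian :=
    isHermitian_kronecker hP.one_sub.isSelfAdjoint isHermitian_one
  have idempotent : IsIdempotentElem (P ⊗ₖ (1 : Matrix n n ℂ)) := by
    rw [IsIdempotentElem, ← mul_kronecker_mul, hP.isIdempotentElem.eq, one_mul]
  have hPQ_kronecker : P ⊗ₖ (1 : Matrix n n ℂ) + (1 - P) ⊗ₖ (1 : Matrix n n ℂ) = 1 := by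
    rw [← add_kronecker, hPQ, one_kronecker_one]
  have offDiag_isHermitian : ((P ⊗ₖ 1) * CFC.sqrt A * ((1 - P) ⊗ₖ (1 : Matrix n n ℂ)) +
      ((1 - P) ⊗ₖ 1) * CFC.sqrt A * (P ⊗ₖ 1)).IsHermitian := by
    rw [IsHermitian, conjTranspose_add]
    simp only [conjTranspose_mul, hP_kronecker.eq, hQ_kronecker.eq, (isHermitian_sqrt A).eq,
      Matrix.mul_assoc, add_comm]
  rw [weakCoherence, sub_weakMeas hPQ, hsNorm_sq, conjTranspose_smul, offDiag_isHermitian.eq,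
    star_trivial, smul_mul_smul_comm, ← sq, ← sq,
    offDiag_sq_eq_neg_commutator_sq idempotent hPQ_kronecker, trace_smul, trace_neg, skewInfo]
  simp only [Complex.smul_re, Complex.neg_re, smul_eq_mul]
  ring

theorem weakCoherence_sum_smul_le (hP : IsStarProjection P) (hPQ : P + Q = 1) (x : ℝ)
    (hp : ∀ i ∈ s, 0 ≤ p i) (hρ : ∀ i ∈ s, (ρ i).PosSemidef) :
    weakCoherence P Q x (∑ i ∈ s, p i • ρ i) ≤ ∑ i ∈ s, p i * weakCoherence P Q x (ρ i) := by
  simp only [weakCoherence_eq_mul_skewInfo hP hPQ, mul_left_comm (p _), ← Finset.mul_sum]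
  exact mul_le_mul_of_nonneg_left
    (skewInfo_sum_smul_le (isHermitian_kronecker hP.isSelfAdjoint isHermitian_one) hp hρ)
    (by positivity)

theorem weakSkewInfo_sum_smul_le (hP : P.IsHermitian) (hQ : Q.IsHermitian) (x : ℝ)
    (hp : ∀ i ∈ s, 0 ≤ p i) (hρ : ∀ i ∈ s, (ρ i).PosSemidef) :
    weakSkewInfo P Q x (∑ i ∈ s, p i • ρ i) ≤ ∑ i ∈ s, p i * weakSkewInfo P Q x (ρ i) := by
  have le (y : ℝ) := skewInfo_sum_smul_le
    (isHermitian_kronecker (isHermitian_weakOp hP hQ y) (isHermitian_one (n := n))) hp hρ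
  simpa only [weakSkewInfo, mul_add, Finset.sum_add_distrib] using add_le_add (le x) (le (-x))

theorem sum_mul_weakAffinity_le (hP : P.IsHermitian) (hQ : Q.IsHermitian) (x : ℝ)
    (hp : ∀ i ∈ s, 0 ≤ p i) (hρ : ∀ i ∈ s, (ρ i).PosSemidef) :
    ∑ i ∈ s, p i * weakAffinity P Q x (ρ i) ≤ weakAffinity P Q x (∑ i ∈ s, p i • ρ i) := by
  have le (y : ℝ) := sum_mul_re_trace_sqrt_mul_sqrt_mul_le
    (isHermitian_kronecker (isHermitian_weakOp hP hQ y) (isHermitian_one (n := n))) hp hρ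
  simpa only [weakAffinity, weakMeas, mul_add, trace_add, Complex.add_re, Finset.sum_add_distrib,
    ← Matrix.mul_assoc] using add_le_add (le x) (le (-x))

end

theorem mainTheorem5_general {m n ι : Type*} [Fintype m] [DecidableEq m] [Fintype n]
    [DecidableEq n] (P Q : Matrix m m ℂ) (hP : IsStarProjection P) (hPQ : P + Q = 1) (x : ℝ)
    {s : Finset ι} {p : ι → ℝ} (hp : ∀ i ∈ s, 0 ≤ p i)
    {ρ : ι → Matrix (m × n) (m × n) ℂ} (hρ : ∀ i ∈ s, (ρ i).PosSemidef) :
    weakCoherence P Q x (∑ i ∈ s, p i • ρ i) ≤ ∑ i ∈ s, p i * weakCoherence P Q x (ρ i) ∧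
      weakSkewInfo P Q x (∑ i ∈ s, p i • ρ i) ≤ ∑ i ∈ s, p i * weakSkewInfo P Q x (ρ i) ∧
      ∑ i ∈ s, p i * weakAffinity P Q x (ρ i) ≤ weakAffinity P Q x (∑ i ∈ s, p i • ρ i) := by
  have hQ : IsStarProjection Q := eq_sub_of_add_eq' hPQ ▸ hP.one_sub
  exact ⟨weakCoherence_sum_smul_le hP hPQ x hp hρ,
    weakSkewInfo_sum_smul_le hP.isSelfAdjoint hQ.isSelfAdjoint x hp hρ,
    sum_mul_weakAffinity_le hP.isSelfAdjoint hQ.isSelfAdjoint x hp hρ⟩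

theorem mainTheorem5 {m n ι : Type*} [Fintype m] [DecidableEq m] [Fintype n] [DecidableEq n]
    [Fintype ι] (P Q : Matrix m m ℂ) (hP : IsStarProjection P) (hQ : IsStarProjection Q)
    (hPQ : P + Q = 1) (x : ℝ) (p : ι → ℝ) (hp : ∀ i, 0 ≤ p i) (hp1 : ∑ i, p i = 1)
    (ρ : ι → Matrix (m × n) (m × n) ℂ) (hρ : ∀ i, IsDensityMatrix (ρ i)) :
    weakCoherence P Q x (∑ i, p i • ρ i) ≤ ∑ i, p i * weakCoherence P Q x (ρ i) ∧
      weakSkewInfo P Q x (∑ i, p i • ρ i) ≤ ∑ i, p i * weakSkewInfo P Q x (ρ i) ∧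
      ∑ i, p i * weakAffinity P Q x (ρ i) ≤ weakAffinity P Q x (∑ i, p i • ρ i) :=
  mainTheorem5_general P Q hP hPQ x (fun i _ => hp i) (fun i _ => (hρ i).1)
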